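/- Let $F(\alpha,\beta,\gamma;x)$ be the principal branch (cut along $[1,\infty)$) of the Gauss hypergeometric function, and define the Seiberg–Witten periods of pure $SU(2)$ theory by $$a(z)=\Big(\tfrac{z+1}{2}\Big)^{1/2}F\Big(-\tfrac12,\tfrac12,1;\tfrac{2}{z+1}\Big),\qquad a_D(z)=i\,\tfrac{z-1}{2}\,F\Big(\tfrac12,\tfrac12,2;\tfrac{1-z}{2}\Big),$$ with principal branches, where on the cut $(-\infty,1]$ the functions take their boundary values from the upper half plane (in particular $a(-1)=2i/\pi$). Let $\mathcal C=\{z\in\mathbb C:\operatorname{Im}(a_D(z)/a(z))=0\}$ be the curve of marginal stability, and let $\mathcal M_+$ be the region outside $\mathcal C$, i.e. the set of points of $\mathbb C\setminus\mathcal C$ whose connected component in $\mathbb C\setminus\mathcal C$ is unbounded. Theorem. Let $p,q\in\mathbb R$ be not both zero and let $f(z)=p\,a(z)+q\,a_D(z)$. Let $z_0\in\mathcal C$ and $z\in\mathcal M_+$ be such that $\operatorname{Im}\big(f(z)/f(z_0)\big)=0$ and, if $q\neq0$, such that $f(z)$ and $f(z_0)$ are nonzero and have the same phase, i.e. $\operatorname{Re}\big(f(z)/f(z_0)\big)>0$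 (for $q=0$ this second condition need not be assumed). Then $|f(z)|>|f(z_0)|$. -/

import Mathlib

namespace SeibergWitten

noncomputable section

/-- The principal branch of the Gauss hypergeometric function `F(a, b, c; x)` for
`0 < Re b < Re c`, given by Euler's integral
`Γ(c) / (Γ(b) Γ(c - b)) * ∫₀¹ t ^ (b - 1) (1 - t) ^ (c - b - 1) (1 - x t) ^ (-a) dt`.
It is holomorphic off the cut `[1, ∞)`; on the cut, Mathlib's convention `arg ∈ (-π, π]` makes
it the limit from `Im x < 0`. -/
def hypergeom (a b c x : ℂ) : ℂ :=
  Complex.Gamma c / (Complex.Gamma b * Complex.Gamma (c - b)) *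
    ∫ t in (0 : ℝ)..1, (t : ℂ) ^ (b - 1) * (1 - (t : ℂ)) ^ (c - b - 1) * (1 - x * (t : ℂ)) ^ (-a)

/-- The period `a(z) = ((z + 1) / 2) ^ (1 / 2) F(-1/2, 1/2, 1; 2 / (z + 1))`, holomorphic off
`(-∞, 1]`. On the cut the formula gives the limit from the upper half plane; at `z = -1`,
where the formula has no meaning, that limit is `2 i / π`. -/
def a (z : ℂ) : ℂ :=
  if z = -1 then 2 * Complex.I / (Real.pi : ℂ)
  else ((z + 1) / 2) ^ (1 / 2 : ℂ) * hypergeom (-1 / 2) (1 / 2) 1 (2 / (z + 1))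

/-- The dual period `a_D(z) = i (z - 1) / 2 * F(1/2, 1/2, 2; (1 - z) / 2)`, holomorphic off
`(-∞, -1]`. On the cut the formula gives the limit from the upper half plane. -/
def aD (z : ℂ) : ℂ :=
  Complex.I * ((z - 1) / 2) * hypergeom (1 / 2) (1 / 2) 2 ((1 - z) / 2)

/-- The central charge `f(z) = p a(z) + q a_D(z)`. -/
def centralCharge (p q : ℝ) (z : ℂ) : ℂ := (p : ℂ) * a z + (q : ℂ) * aD z

/-- The curve of marginal stability `Im (a_D / a) = 0`. -/
def marginalCurve : Set ℂ := {z | (aD z / a z).im = 0}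

/-- The weak-coupling region: the region outside the (closed) curve of marginal stability,
i.e. the points whose connected component in the complement of the curve is unbounded. -/
def weakRegion : Set ℂ :=
  {z | z ∉ marginalCurve ∧ ¬ Bornology.IsBounded (connectedComponentIn marginalCurveᶜ z)}

end

end SeibergWitten

open Complex MeasureTheory Set Filter Topology ComplexConjugate

namespace SeibergWitten

noncomputable section

/-! Put K = Im(conj a · a_D), a quadratic form on period vectors Π = (a, a_D). It vanishes on the
curve and is positive in the weak region. If f(z) = c f(z₀) with c > 0, the vector Π(z) - cΠ(z₀) is
killed by the real pair (p, q), so K vanishes on it. Expanding, and using K(Π(z₀)) = 0, gives (c -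
1) K(Π(z)) = c K(Π(z) - Π(z₀)). Hence c > 1 as soon as K is positive on differences of period
vectors (`periods_difference_pos`).

For that, Euler's integrals become means over θ of square roots with values in the closed first
quadrant. In the coordinate ζ = (z + 1)/2 a difference of roots is (ζ - ζ₀) times a real factor over
a sum of roots. So Δa = (ζ - ζ₀)A and Δa_D = 2i(ζ - ζ₀)D with A, D in the closed fourth quadrant,
and K(ΔΠ) = 2|ζ - ζ₀|² Re(conj A · D) > 0. The lower half plane follows by conjugation.

K > 0 in the weak region because {K < 0} is bounded: K changes sign only across the curve, so a
component containing a point with K < 0 would be bounded. For q = 0, positivity of c comes from the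
half plane containing the values of a. -/

/-! ### Square roots in the closed upper half plane. -/

/-- A continuous function on `ℂ` which on the closed upper half plane is the principal square
root. -/
def upperSqrt (w : ℂ) : ℂ := ⟨√((‖w‖ + w.re) / 2), √((‖w‖ - w.re) / 2)⟩

theorem upperSqrt_re (w : ℂ) : (upperSqrt w).re = √((‖w‖ + w.re) / 2) := rfl

theorem upperSqrt_im (w : ℂ) : (upperSqrt w).im = √((‖w‖ - w.re) / 2) := rfl

theorem upperSqrt_re_nonneg (w : ℂ) : 0 ≤ (upperSqrt w).re := Real.sqrt_nonneg _

theorem upperSqrt_im_nonneg (w : ℂ) : 0 ≤ (upperSqrt w).im := Real.sqrt_nonneg _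

theorem cpow_half_eq_upperSqrt {w : ℂ} (hw : 0 ≤ w.im) : w ^ (1 / 2 : ℂ) = upperSqrt w := by
  rw [one_div]
  exact Complex.ext (cpow_inv_two_re w) (cpow_inv_two_im_eq_sqrt hw)

theorem upperSqrt_sq {w : ℂ} (hw : 0 ≤ w.im) : upperSqrt w ^ 2 = w := by
  rw [← cpow_half_eq_upperSqrt hw, one_div]
  exact cpow_nat_inv_pow w two_ne_zero

theorem upperSqrt_re_sq_sub_im_sq {w : ℂ} (hw : 0 ≤ w.im) :
    (upperSqrt w).re * (upperSqrt w).re - (upperSqrt w).im * (upperSqrt w).im = w.re := by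
  have h := congrArg Complex.re (upperSqrt_sq hw)
  simpa [sq] using h

theorem two_mul_upperSqrt_re_mul_im {w : ℂ} (hw : 0 ≤ w.im) :
    2 * ((upperSqrt w).re * (upperSqrt w).im) = w.im := by
  have h := congrArg Complex.im (upperSqrt_sq hw)
  simp only [sq, mul_im] at h
  linarith

theorem upperSqrt_ofReal_of_nonneg {x : ℝ} (hx : 0 ≤ x) : upperSqrt x = (√x : ℝ) := by
  apply Complex.ext <;> simp [upperSqrt_re, upperSqrt_im, abs_of_nonneg hx]

theorem upperSqrt_ofReal_of_nonpos {x : ℝ} (hx : x ≤ 0) :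
    upperSqrt x = (√(-x) : ℝ) * I := by
  have h : (-x - x) / 2 = -x := by ring
  apply Complex.ext <;> simp [upperSqrt_re, upperSqrt_im, abs_of_nonpos hx, h, -neg_add_rev]

theorem continuous_upperSqrt : Continuous upperSqrt := by
  have : upperSqrt = fun w => equivRealProdCLM.symm
      (√((‖w‖ + w.re) / 2), √((‖w‖ - w.re) / 2)) := by
    funext w; apply Complex.ext <;> simp [upperSqrt]
  rw [this]
  fun_prop

theorem upperSqrt_eq_zero {w : ℂ} (hw : 0 ≤ w.im) : upperSqrt w = 0 ↔ w = 0 := by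
  rw [← pow_eq_zero_iff two_ne_zero, upperSqrt_sq hw]

theorem upperSqrt_re_pos {w : ℂ} (hw : 0 ≤ w.im) (h : 0 < w.im ∨ 0 < w.re) :
    0 < (upperSqrt w).re := by
  refine (upperSqrt_re_nonneg w).lt_of_ne' fun h0 => ?_
  have h1 := upperSqrt_re_sq_sub_im_sq hw
  have h2 := two_mul_upperSqrt_re_mul_im hw
  rw [h0] at h1 h2
  rcases h with h | h
  · linarith
  · nlinarith [mul_self_nonneg (upperSqrt w).im]

theorem upperSqrt_im_pos {w : ℂ} (hw : 0 ≤ w.im) (h : 0 < w.im ∨ w.re < 0) :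
    0 < (upperSqrt w).im := by
  refine (upperSqrt_im_nonneg w).lt_of_ne' fun h0 => ?_
  have h1 := upperSqrt_re_sq_sub_im_sq hw
  have h2 := two_mul_upperSqrt_re_mul_im hw
  rw [h0] at h1 h2
  rcases h with h | h
  · linarith
  · nlinarith [mul_self_nonneg (upperSqrt w).re]

/-- The squares agree, so only the sign is in question. All roots lie in the closed first quadrant,
so a wrong sign forces the product to be real, which is excluded or harmless in each position of ζ.
-/
theorem upperSqrt_mul_upperSqrt {ζ : ℂ} (hζ : 0 ≤ ζ.im) (h0 : ζ ≠ 0) {t : ℝ} (ht : 0 ≤ t) :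
    upperSqrt ζ * upperSqrt (1 - t / ζ) = upperSqrt (ζ - t) := by
  have him : (1 - t / ζ).im = t * ζ.im / normSq ζ := by
    simp [div_im]
  have hre : (1 - t / ζ).re = 1 - t * ζ.re / normSq ζ := by
    simp [div_re]
  have hN : 0 < normSq ζ := normSq_pos.2 h0
  have hη : 0 ≤ (1 - t / ζ).im := by rw [him]; positivity
  have hζt : 0 ≤ (ζ - t).im := by simpa using hζ
  set P := upperSqrt ζ * upperSqrt (1 - t / ζ) with hP
  have hsq : P ^ 2 = upperSqrt (ζ - t) ^ 2 := by
    rw [hP, mul_pow, upperSqrt_sq hζ, upperSqrt_sq hη, upperSqrt_sq hζt]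
    field_simp
  have hPim : P.im = (upperSqrt ζ).re * (upperSqrt (1 - t / ζ)).im
      + (upperSqrt ζ).im * (upperSqrt (1 - t / ζ)).re := by rw [hP, mul_im]
  have hPre : P.re = (upperSqrt ζ).re * (upperSqrt (1 - t / ζ)).re
      - (upperSqrt ζ).im * (upperSqrt (1 - t / ζ)).im := by rw [hP, mul_re]
  have a1 := upperSqrt_re_nonneg ζ
  have a2 := upperSqrt_im_nonneg ζ
  have a3 := upperSqrt_re_nonneg (1 - t / ζ)
  have a4 := upperSqrt_im_nonneg (1 - t / ζ)
  have c1 := upperSqrt_re_sq_sub_im_sq hζ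
  have c2 := two_mul_upperSqrt_re_mul_im hζ
  have c3 := upperSqrt_re_sq_sub_im_sq hη
  have c4 := two_mul_upperSqrt_re_mul_im hη
  rcases sq_eq_sq_iff_eq_or_eq_neg.1 hsq with h | h
  · exact h
  have h1 := congrArg Complex.re h
  have h2 := congrArg Complex.im h
  simp only [neg_re, neg_im] at h1 h2
  have b1 := upperSqrt_re_nonneg (ζ - t)
  have b2 := upperSqrt_im_nonneg (ζ - t)
  have e1 : 0 ≤ (upperSqrt ζ).re * (upperSqrt (1 - t / ζ)).im := mul_nonneg a1 a4
  have e2 : 0 ≤ (upperSqrt ζ).im * (upperSqrt (1 - t / ζ)).re := mul_nonneg a2 a3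
  have hI : P.im = 0 := by linarith
  rcases eq_or_lt_of_le hζ with hz | hz
  · have hη0 : (1 - t / ζ).im = 0 := by rw [him, ← hz]; simp
    rw [hη0] at c4
    rw [← hz] at c2
    rcases lt_or_ge ζ.re 0 with hr | hr
    · have : 0 < (1 - t / ζ).re := by
        rw [hre]
        have : t * ζ.re / normSq ζ ≤ 0 :=
          div_nonpos_of_nonpos_of_nonneg (by nlinarith) hN.le
        linarith
      have p1 := upperSqrt_re_pos hη (Or.inr this)
      have p2 := upperSqrt_im_pos hζ (Or.inr hr)
      nlinarith [mul_pos p1 p2]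
    · have hr' : 0 < ζ.re := hr.lt_of_ne fun h => h0 (Complex.ext h.symm hz.symm)
      have p1 := upperSqrt_re_pos hζ (Or.inr hr')
      have hi0 : (upperSqrt ζ).im = 0 := by
        rcases mul_eq_zero.1 (by linarith : (upperSqrt ζ).re * (upperSqrt ζ).im = 0) with h | h
        · exact absurd h p1.ne'
        · exact h
      rw [hi0] at hPre
      have : 0 ≤ P.re := by rw [hPre]; nlinarith
      apply Complex.ext <;> linarith
  · exfalso
    have p1 := upperSqrt_re_pos hζ (Or.inl hz)
    have p2 := upperSqrt_im_pos hζ (Or.inl hz)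
    have q1 : (upperSqrt (1 - t / ζ)).im = 0 := by
      by_contra hne
      have := mul_pos p1 (a4.lt_of_ne' hne)
      linarith
    have q2 : (upperSqrt (1 - t / ζ)).re = 0 := by
      by_contra hne
      have := mul_pos p2 (a3.lt_of_ne' hne)
      linarith
    have : (1 - t / ζ) = 0 := (upperSqrt_eq_zero hη).1 (Complex.ext q2 q1)
    have h3 : ζ = t := by field_simp at this; linear_combination this
    rw [h3] at hz
    simp at hz

/-! ### Euler's integrals as trigonometric means. -/

theorem image_sin_sq_Ioo :
    (fun θ : ℝ => Real.sin θ ^ 2) '' Ioo 0 (Real.pi / 2) = Ioo 0 1 := by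
  ext t
  simp only [mem_image, mem_Ioo]
  constructor
  · rintro ⟨θ, ⟨h1, h2⟩, rfl⟩
    have hs : 0 < Real.sin θ := Real.sin_pos_of_pos_of_lt_pi h1 (by linarith)
    have hc : 0 < Real.cos θ := Real.cos_pos_of_mem_Ioo ⟨by linarith, h2⟩
    constructor
    · positivity
    · nlinarith [Real.sin_sq_add_cos_sq θ]
  · rintro ⟨h1, h2⟩
    refine ⟨Real.arcsin (√t), ⟨Real.arcsin_pos.2 (Real.sqrt_pos.2 h1), ?_⟩, ?_⟩
    · rw [Real.arcsin_lt_pi_div_two, Real.sqrt_lt' one_pos]; simpa using h2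
    · rw [Real.sin_arcsin (by linarith [Real.sqrt_nonneg t]) (Real.sqrt_le_one.2 h2.le),
        Real.sq_sqrt h1.le]

/-- The substitution `t = sin² θ`. -/
theorem integral_eq_integral_sin_sq (F : ℝ → ℂ) :
    ∫ t in (0 : ℝ)..1, F t =
      ∫ θ in (0 : ℝ)..Real.pi / 2, (2 * Real.sin θ * Real.cos θ : ℝ) * F (Real.sin θ ^ 2) := by
  have hpi := Real.pi_pos
  rw [intervalIntegral.integral_of_le zero_le_one, intervalIntegral.integral_of_le (by positivity),
    integral_Ioc_eq_integral_Ioo, integral_Ioc_eq_integral_Ioo, ← image_sin_sq_Ioo,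
    integral_image_eq_integral_abs_deriv_smul (f' := fun θ => 2 * Real.sin θ * Real.cos θ)
      measurableSet_Ioo]
  · refine setIntegral_congr_fun measurableSet_Ioo fun θ hθ => ?_
    have hs : 0 < Real.sin θ := Real.sin_pos_of_pos_of_lt_pi hθ.1 (by linarith [hθ.2])
    have hc : 0 < Real.cos θ := Real.cos_pos_of_mem_Ioo ⟨by linarith [hθ.1], hθ.2⟩
    simp only [abs_of_pos (by positivity : 0 < 2 * Real.sin θ * Real.cos θ), real_smul]
  · intro θ _
    simpa using ((Real.hasDerivAt_sin θ).fun_pow 2).hasDerivWithinAt (s := Ioo 0 (Real.pi / 2))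
  · intro θ hθ φ hφ h
    have h1 : 0 < Real.sin θ := Real.sin_pos_of_pos_of_lt_pi hθ.1 (by linarith [hθ.2])
    have h2 : 0 < Real.sin φ := Real.sin_pos_of_pos_of_lt_pi hφ.1 (by linarith [hφ.2])
    have h3 : Real.sin θ = Real.sin φ := by
      have h' : Real.sin θ ^ 2 = Real.sin φ ^ 2 := h
      nlinarith
    exact Real.injOn_sin ⟨by linarith [hθ.1], hθ.2.le⟩ ⟨by linarith [hφ.1], hφ.2.le⟩ h3

/-- The mean value over the quarter period `[0, π / 2]`. -/
def quarterMean (g : ℝ → ℂ) : ℂ := (2 / Real.pi : ℝ) * ∫ θ in (0 : ℝ)..Real.pi / 2, g θ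

theorem ofReal_cpow_half_sub_one {x : ℝ} (hx : 0 < x) :
    ((x ^ 2 : ℝ) : ℂ) ^ ((1 / 2 : ℂ) - 1) = ((x⁻¹ : ℝ) : ℂ) := by
  have h : ((1 / 2 : ℂ) - 1) = ((-(1 / 2) : ℝ) : ℂ) := by push_cast; ring
  rw [h, ← ofReal_cpow (by positivity), Real.rpow_neg (by positivity), ← Real.sqrt_eq_rpow,
    Real.sqrt_sq hx.le]

theorem integral_arcsine_weight_mul (F : ℝ → ℂ) :
    ∫ t in (0 : ℝ)..1, (t : ℂ) ^ ((1 / 2 : ℂ) - 1) * (1 - (t : ℂ)) ^ ((1 / 2 : ℂ) - 1) * F t =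
      Real.pi * quarterMean fun θ => F (Real.sin θ ^ 2) := by
  have hpi := Real.pi_pos
  have hpi' : (Real.pi : ℂ) ≠ 0 := ofReal_ne_zero.2 hpi.ne'
  rw [integral_eq_integral_sin_sq, quarterMean, ← mul_assoc, ← ofReal_mul,
    ← intervalIntegral.integral_const_mul]
  rw [intervalIntegral.integral_of_le (by positivity), intervalIntegral.integral_of_le
    (by positivity), integral_Ioc_eq_integral_Ioo, integral_Ioc_eq_integral_Ioo]
  refine setIntegral_congr_fun measurableSet_Ioo fun θ hθ => ?_
  have hs : 0 < Real.sin θ := Real.sin_pos_of_pos_of_lt_pi hθ.1 (by linarith [hθ.2])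
  have hc : 0 < Real.cos θ := Real.cos_pos_of_mem_Ioo ⟨by linarith [hθ.1], hθ.2⟩
  have h1 : (1 : ℂ) - ((Real.sin θ ^ 2 : ℝ) : ℂ) = ((Real.cos θ ^ 2 : ℝ) : ℂ) := by
    rw [Real.cos_sq']; push_cast; ring
  have hs' : ((Real.sin θ : ℝ) : ℂ) ≠ 0 := ofReal_ne_zero.2 hs.ne'
  have hc' : ((Real.cos θ : ℝ) : ℂ) ≠ 0 := ofReal_ne_zero.2 hc.ne'
  simp only [h1, ofReal_cpow_half_sub_one hs, ofReal_cpow_half_sub_one hc]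
  push_cast at hs' hc' ⊢
  field_simp

/-- The period `a` on the closed upper half plane, as a function of `ζ = (z + 1) / 2`. -/
def upperPeriod (ζ : ℂ) : ℂ := quarterMean fun θ => upperSqrt (ζ - (Real.sin θ ^ 2 : ℝ))

/-- The dual period `a_D` on the closed upper half plane, as a function of `ζ = (z + 1) / 2`. -/
def upperDualPeriod (ζ : ℂ) : ℂ := 2 * I * quarterMean fun θ =>
  (ζ - 1) / (1 + upperSqrt (1 - (Real.sin θ ^ 2 : ℝ) + ζ * (Real.sin θ ^ 2 : ℝ)))

theorem upperPeriod_zero : upperPeriod 0 = 2 * I / (Real.pi : ℂ) := by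
  have h : ∀ θ ∈ uIcc (0 : ℝ) (Real.pi / 2),
      upperSqrt (0 - (Real.sin θ ^ 2 : ℝ)) = (Real.sin θ : ℝ) * I := by
    intro θ hθ
    rw [uIcc_of_le (by positivity)] at hθ
    have hs : 0 ≤ Real.sin θ := Real.sin_nonneg_of_nonneg_of_le_pi hθ.1
      (by linarith [hθ.2, Real.pi_pos])
    rw [zero_sub, ← ofReal_neg, upperSqrt_ofReal_of_nonpos (by nlinarith), neg_neg,
      Real.sqrt_sq hs]
  rw [upperPeriod, quarterMean, intervalIntegral.integral_congr h,
    intervalIntegral.integral_mul_const, intervalIntegral.integral_ofReal, integral_sin]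
  simp
  ring

theorem Gamma_half_mul_Gamma_half : Complex.Gamma (1 / 2) * Complex.Gamma (1 / 2) = Real.pi := by
  rw [Complex.Gamma_one_half_eq, ← cpow_add _ _ (ofReal_ne_zero.2 Real.pi_pos.ne')]
  norm_num

theorem a_eq_upperPeriod {z : ℂ} (hz : 0 ≤ z.im) : a z = upperPeriod ((z + 1) / 2) := by
  rw [a]
  split_ifs with h
  · rw [h, ← upperPeriod_zero]; norm_num
  · set ζ : ℂ := (z + 1) / 2 with hζ
    have h0 : ζ ≠ 0 := by
      intro h'; apply h; rw [hζ] at h'; linear_combination 2 * h'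
    have him : 0 ≤ ζ.im := by
      have : ζ.im = z.im / 2 := by rw [hζ]; simp
      rw [this]; positivity
    have hpi' : (Real.pi : ℂ) ≠ 0 := ofReal_ne_zero.2 Real.pi_pos.ne'
    have hinv : 2 / (z + 1) = 1 / ζ := by rw [hζ, one_div_div]
    rw [hinv, hypergeom]
    have e : (1 : ℂ) - 1 / 2 - 1 = 1 / 2 - 1 := by ring
    have e2 : (1 : ℂ) - 1 / 2 = 1 / 2 := by norm_num
    have e3 : -(-1 / 2 : ℂ) = 1 / 2 := by norm_num
    rw [e, e2, e3, integral_arcsine_weight_mul (fun t => (1 - 1 / ζ * (t : ℂ)) ^ (1 / 2 : ℂ)),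
      Gamma_half_mul_Gamma_half, Complex.Gamma_one, upperPeriod, ← mul_assoc (1 / (Real.pi : ℂ)),
      one_div_mul_cancel hpi', one_mul, quarterMean, quarterMean, mul_left_comm,
      ← intervalIntegral.integral_const_mul]
    congr 2
    funext θ
    have h1 : 1 - 1 / ζ * ((Real.sin θ ^ 2 : ℝ) : ℂ) = 1 - ((Real.sin θ ^ 2 : ℝ) : ℂ) / ζ := by
      ring
    have h2 : (1 - ((Real.sin θ ^ 2 : ℝ) : ℂ) / ζ).im = Real.sin θ ^ 2 * ζ.im / normSq ζ := by
      rw [sub_im, one_im, div_im, ofReal_re, ofReal_im]; ring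
    have h3 : 0 ≤ (1 - ((Real.sin θ ^ 2 : ℝ) : ℂ) / ζ).im := by
      rw [h2]; have := normSq_nonneg ζ; positivity
    rw [h1, cpow_half_eq_upperSqrt him, cpow_half_eq_upperSqrt h3,
      upperSqrt_mul_upperSqrt him h0 (sq_nonneg _)]

/-- A continuous square root of a differentiable function is differentiable where it does not
vanish. -/
theorem hasDerivAt_of_sq_hasDerivAt {Q : ℝ → ℂ} {w : ℝ → ℂ} {w' : ℂ} {t : ℝ}
    (hw : HasDerivAt w w' t) (hQ : ContinuousAt Q t) (hsq : ∀ᶠ s in 𝓝 t, Q s ^ 2 = w s)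
    (h0 : Q t ≠ 0) : HasDerivAt Q (w' / (2 * Q t)) t := by
  rw [hasDerivAt_iff_tendsto_slope] at hw ⊢
  have hsum : Tendsto (fun s => Q s + Q t) (𝓝[≠] t) (𝓝 (2 * Q t)) := by
    rw [two_mul]
    exact (hQ.tendsto.mono_left nhdsWithin_le_nhds).add tendsto_const_nhds
  have h2 : 2 * Q t ≠ 0 := mul_ne_zero two_ne_zero h0
  refine (hw.div hsum h2).congr' ?_
  filter_upwards [hsum.eventually_ne h2, hsq.filter_mono nhdsWithin_le_nhds] with s hs hs2
  rw [Pi.div_apply, slope_def_module, slope_def_module, ← hs2, ← hsq.self_of_nhds, real_smul, real_smul]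
  field_simp
  ring

theorem dual_radicand_im_nonneg {ζ : ℂ} (hζ : 0 ≤ ζ.im) {t : ℝ} (ht : 0 ≤ t) :
    0 ≤ (1 - (t : ℂ) + ζ * t).im := by
  simp; positivity

theorem one_add_upperSqrt_ne_zero (w : ℂ) : 1 + upperSqrt w ≠ 0 := by
  intro h
  have := congrArg Complex.re h
  simp only [add_re, one_re, zero_re] at this
  linarith [upperSqrt_re_nonneg w]

theorem intervalIntegrable_abs_one_sub_mul_rpow (c : ℝ) :
    IntervalIntegrable (fun t : ℝ => |1 - c * t| ^ (-(1 / 2) : ℝ)) volume 0 1 := by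
  rcases eq_or_ne c 0 with rfl | hc
  · simp
  have h : IntervalIntegrable (fun y : ℝ => |y| ^ (-(1 / 2) : ℝ)) volume 1 (1 - c) := by
    have := (intervalIntegral.intervalIntegrable_cpow' (a := 1) (b := 1 - c)
      (r := ((-(1 / 2) : ℝ) : ℂ)) (by rw [ofReal_re]; norm_num)).norm
    simpa only [norm_cpow_real, norm_real, Real.norm_eq_abs] using this
  have h2 := (h.comp_sub_left 1).comp_mul_left (c := c)
  simpa [hc] using h2

theorem intervalIntegrable_dual_integrand {ζ : ℂ} (hζ : 0 ≤ ζ.im) :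
    IntervalIntegrable (fun t : ℝ => (t : ℂ) ^ ((1 / 2 : ℂ) - 1) *
      (1 - (t : ℂ)) ^ ((2 : ℂ) - 1 / 2 - 1) * (1 - (1 - ζ) * (t : ℂ)) ^ (-(1 / 2) : ℂ))
      volume 0 1 := by
  have hbeta : IntervalIntegrable (fun t : ℝ => (t : ℂ) ^ ((1 / 2 : ℂ) - 1) *
      (1 - (t : ℂ)) ^ ((2 : ℂ) - 1 / 2 - 1)) volume 0 1 :=
    betaIntegral_convergent (by norm_num) (by norm_num)
  rcases eq_or_lt_of_le hζ with h0 | hpos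
  · set c := 1 - ζ.re with hc
    have hx : (1 : ℂ) - ζ = (c : ℂ) := by
      apply Complex.ext <;> simp [hc, ← h0]
    rw [hx]
    -- For real ζ the last factor may blow up at t = 1/c. Either |1 - ct| ≥ 1/2 or t ≥ 1/(2|c|), so
    -- at most one of the two singular factors is large. For c = 0 only the first case occurs.
    have hdom : IntervalIntegrable (fun t : ℝ => ((1 / 2 : ℝ) ^ (-(1 / 2) : ℝ)) *
        |1 - 1 * (1 - t)| ^ (-(1 / 2) : ℝ) + ((1 / (2 * |c|)) ^ (-(1 / 2) : ℝ)) *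
        |1 - c * t| ^ (-(1 / 2) : ℝ)) volume 0 1 := by
      refine IntervalIntegrable.add (IntervalIntegrable.const_mul ?_ _)
        (IntervalIntegrable.const_mul (intervalIntegrable_abs_one_sub_mul_rpow c) _)
      have := (intervalIntegrable_abs_one_sub_mul_rpow 1).comp_sub_left 1
      simpa using this.symm
    refine hdom.mono_fun' (by fun_prop) ?_
    rw [uIoc_of_le zero_le_one]
    refine (ae_restrict_iff' measurableSet_Ioc).2 (Eventually.of_forall fun t ht => ?_)
    have e1 : ((1 / 2 : ℂ) - 1) = ((-(1 / 2) : ℝ) : ℂ) := by push_cast; ring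
    have e2 : ((2 : ℂ) - 1 / 2 - 1) = ((1 / 2 : ℝ) : ℂ) := by push_cast; ring
    have e3 : (-(1 / 2) : ℂ) = ((-(1 / 2) : ℝ) : ℂ) := by push_cast; ring
    have e4 : (1 : ℂ) - t = ((1 - t : ℝ) : ℂ) := by push_cast; ring
    have e5 : (1 : ℂ) - c * t = ((1 - c * t : ℝ) : ℂ) := by push_cast; ring
    beta_reduce
    rw [norm_mul, norm_mul, e1, e2, e3, e4, e5]
    simp only [norm_cpow_real, norm_real, Real.norm_eq_abs]
    have ht0 : 0 < t := ht.1
    have h1 : |1 - t| ^ (1 / 2 : ℝ) ≤ 1 :=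
      Real.rpow_le_one (abs_nonneg _) (by rw [abs_le]; constructor <;> linarith [ht.2])
        (by norm_num)
    have h2 : |1 - 1 * (1 - t)| = |t| := by ring_nf
    rw [h2, abs_of_pos ht0]
    have p1 : 0 ≤ t ^ (-(1 / 2) : ℝ) := Real.rpow_nonneg ht0.le _
    have p2 : 0 ≤ |1 - c * t| ^ (-(1 / 2) : ℝ) := Real.rpow_nonneg (abs_nonneg _) _
    have p3 : 0 ≤ (1 / (2 * |c|)) ^ (-(1 / 2) : ℝ) := Real.rpow_nonneg (by positivity) _
    have p4 : 0 ≤ (1 / 2 : ℝ) ^ (-(1 / 2) : ℝ) := Real.rpow_nonneg (by positivity) _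
    have key : t ^ (-(1 / 2) : ℝ) * |1 - t| ^ (1 / 2 : ℝ) * |1 - c * t| ^ (-(1 / 2) : ℝ) ≤
        t ^ (-(1 / 2) : ℝ) * |1 - c * t| ^ (-(1 / 2) : ℝ) :=
      mul_le_mul_of_nonneg_right (mul_le_of_le_one_right p1 h1) p2
    refine key.trans ?_
    rcases le_or_gt (1 / 2) |1 - c * t| with h | h
    · have : |1 - c * t| ^ (-(1 / 2) : ℝ) ≤ (1 / 2 : ℝ) ^ (-(1 / 2) : ℝ) :=
        Real.rpow_le_rpow_of_nonpos (by norm_num) h (by norm_num)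
      nlinarith [mul_le_mul_of_nonneg_left this p1, mul_nonneg p3 p2]
    · have hct : 1 / 2 ≤ c * t := by linarith [(abs_lt.1 h).2]
      have hc0 : 0 < c := by
        by_contra hneg
        nlinarith
      have : 1 / (2 * |c|) ≤ t := by
        rw [abs_of_pos hc0, div_le_iff₀ (by positivity)]
        linarith
      have : t ^ (-(1 / 2) : ℝ) ≤ (1 / (2 * |c|)) ^ (-(1 / 2) : ℝ) :=
        Real.rpow_le_rpow_of_nonpos (by positivity) this (by norm_num)
      nlinarith [mul_le_mul_of_nonneg_right this p2, mul_nonneg p4 p1]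
  · refine hbeta.mul_continuousOn ?_
    rw [uIcc_of_le zero_le_one]
    refine ContinuousOn.cpow_const (by fun_prop) fun t ht => ?_
    rcases eq_or_lt_of_le ht.1 with h | h
    · rw [← h]; simp
    · right
      have : (1 - (1 - ζ) * (t : ℂ)).im = ζ.im * t := by simp
      rw [this]
      positivity

/-- The two integrands differ by the derivative of -2√(t(1 - t))/(1 + Q), which vanishes at both
endpoints. This trades 1/Q, possibly singular, for the continuous 1/(1 + Q). -/
theorem integral_dual_integrand {ζ : ℂ} (hζ : 0 ≤ ζ.im) :
    ∫ t in (0 : ℝ)..1, (t : ℂ) ^ ((1 / 2 : ℂ) - 1) *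
      (1 - (t : ℂ)) ^ ((2 : ℂ) - 1 / 2 - 1) * (1 - (1 - ζ) * (t : ℂ)) ^ (-(1 / 2) : ℂ) =
    Real.pi * quarterMean fun θ =>
      1 / (1 + upperSqrt (1 - (Real.sin θ ^ 2 : ℝ) + ζ * (Real.sin θ ^ 2 : ℝ))) := by
  set Q : ℝ → ℂ := fun t => upperSqrt (1 - (t : ℂ) + ζ * t) with hQ
  have hQc : Continuous Q := continuous_upperSqrt.comp (by fun_prop)
  have hQ1 : ∀ t, 1 + Q t ≠ 0 := fun t => one_add_upperSqrt_ne_zero _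
  have hQsq : ∀ t : ℝ, 0 ≤ t → Q t ^ 2 = 1 - (t : ℂ) + ζ * t := fun t ht =>
    upperSqrt_sq (dual_radicand_im_nonneg hζ ht)
  rw [← integral_arcsine_weight_mul (fun t => 1 / (1 + Q t)), eq_comm, ← sub_eq_zero]
  have hi1 : IntervalIntegrable (fun t : ℝ => (t : ℂ) ^ ((1 / 2 : ℂ) - 1) *
      (1 - (t : ℂ)) ^ ((1 / 2 : ℂ) - 1) * (1 / (1 + Q t))) volume 0 1 :=
    (betaIntegral_convergent (by norm_num) (by norm_num)).mul_continuousOn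
      (Continuous.div continuous_const (by fun_prop) hQ1).continuousOn
  have hi2 := intervalIntegrable_dual_integrand hζ
  rw [← intervalIntegral.integral_sub hi1 hi2]
  -- The antiderivative may fail to be differentiable where Q = 0; the radicand is affine in t and
  -- equals 1 at t = 0, so there is at most one such point.
  have hS : ({t : ℝ | Q t = 0} ∩ Ioo 0 1).Countable := by
    refine Set.Subsingleton.countable fun s hs t ht => ?_
    have h1 := hQsq s hs.2.1.le
    have h2 := hQsq t ht.2.1.le
    rw [hs.1] at h1
    rw [ht.1] at h2
    have hs0 : (s : ℂ) ≠ 0 := ofReal_ne_zero.2 hs.2.1.ne'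
    have : (s : ℂ) = t := by
      have h3 : (1 - ζ) * s = 1 := by linear_combination h1
      have h4 : (1 - ζ) * t = 1 := by linear_combination h2
      have h5 : 1 - ζ ≠ 0 := by rintro h; rw [h] at h3; simp at h3
      exact mul_left_cancel₀ h5 (h3.trans h4.symm)
    exact_mod_cast this
  rw [integral_eq_of_hasDerivAt_off_countable_of_le
    (fun t => -2 * ((√t * √(1 - t) : ℝ) : ℂ) / (1 + Q t)) _ zero_le_one hS ?_ ?_ (hi1.sub hi2)]
  · simp
  · exact (Continuous.div (by fun_prop) (by fun_prop) hQ1).continuousOn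
  · rintro t ⟨ht, htS⟩
    have ht0 : 0 < t := ht.1
    have ht1 : 0 < 1 - t := by linarith [ht.2]
    have hQ0 : Q t ≠ 0 := fun h => htS ⟨h, ht⟩
    have hw : HasDerivAt (fun s : ℝ => 1 - (s : ℂ) + ζ * s) (ζ - 1) t := by
      have := ((hasDerivAt_id t).ofReal_comp)
      refine HasDerivAt.congr_deriv ((this.const_sub 1).add (this.const_mul ζ)) ?_
      push_cast; ring
    have hQd : HasDerivAt Q ((ζ - 1) / (2 * Q t)) t := by
      refine hasDerivAt_of_sq_hasDerivAt hw hQc.continuousAt ?_ hQ0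
      filter_upwards [lt_mem_nhds ht0] with s hs using hQsq s hs.le
    have hr : HasDerivAt (fun s : ℝ => √s * √(1 - s))
        (1 / (2 * √t) * √(1 - t) + √t * (-1 / (2 * √(1 - t)))) t := by
      refine (Real.hasDerivAt_sqrt ht0.ne').mul ?_
      exact ((hasDerivAt_id t).const_sub 1).sqrt ht1.ne'
    have hd := ((hr.ofReal_comp.const_mul (-2 : ℂ)).div (hQd.const_add 1) (hQ1 t))
    refine HasDerivAt.congr_deriv hd ?_
    have hr0 : 0 < √t := Real.sqrt_pos.2 ht0
    have hr1 : 0 < √(1 - t) := Real.sqrt_pos.2 ht1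
    have e1 : (t : ℂ) ^ ((1 / 2 : ℂ) - 1) = ((√t)⁻¹ : ℝ) := by
      conv_lhs => rw [← Real.sq_sqrt ht0.le]
      exact ofReal_cpow_half_sub_one hr0
    have e2 : (1 - (t : ℂ)) ^ ((1 / 2 : ℂ) - 1) = ((√(1 - t))⁻¹ : ℝ) := by
      have : (1 : ℂ) - t = ((1 - t : ℝ) : ℂ) := by push_cast; ring
      rw [this]
      conv_lhs => rw [← Real.sq_sqrt ht1.le]
      exact ofReal_cpow_half_sub_one hr1
    have e3 : (1 - (t : ℂ)) ^ ((2 : ℂ) - 1 / 2 - 1) = ((√(1 - t) : ℝ) : ℂ) := by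
      have : (1 : ℂ) - t = ((1 - t : ℝ) : ℂ) := by push_cast; ring
      have h' : (2 : ℂ) - 1 / 2 - 1 = 1 / 2 := by norm_num
      rw [h', this, cpow_half_eq_upperSqrt (by simp), upperSqrt_ofReal_of_nonneg ht1.le]
    have e4 : (1 - (1 - ζ) * (t : ℂ)) ^ (-(1 / 2) : ℂ) = (Q t)⁻¹ := by
      have : 1 - (1 - ζ) * (t : ℂ) = 1 - (t : ℂ) + ζ * t := by ring
      rw [this, cpow_neg, cpow_half_eq_upperSqrt (dual_radicand_im_nonneg hζ ht0.le)]
    rw [e1, e2, e3, e4]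
    have hsq := hQsq t ht0.le
    have ha : ((√t : ℝ) : ℂ) ^ 2 = t := by rw [← ofReal_pow, Real.sq_sqrt ht0.le]
    have hb : ((√(1 - t) : ℝ) : ℂ) ^ 2 = 1 - t := by
      rw [← ofReal_pow, Real.sq_sqrt ht1.le]; push_cast; ring
    have hA : ((√t : ℝ) : ℂ) ≠ 0 := ofReal_ne_zero.2 hr0.ne'
    have hB : ((√(1 - t) : ℝ) : ℂ) ≠ 0 := ofReal_ne_zero.2 hr1.ne'
    have hq1 := hQ1 t
    push_cast
    generalize ((√t : ℝ) : ℂ) = α at *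
    generalize ((√(1 - t) : ℝ) : ℂ) = β at *
    generalize Q t = q at *
    have hz : (ζ - 1) * α ^ 2 = q ^ 2 - 1 := by rw [ha, hsq]; ring
    have hab : β ^ 2 = 1 - α ^ 2 := by rw [hb, ha]
    field_simp
    linear_combination β ^ 2 * hz + (1 + q) * q * hab

theorem quarterMean_const_mul (c : ℂ) (g : ℝ → ℂ) :
    (quarterMean fun θ => c * g θ) = c * quarterMean g := by
  rw [quarterMean, quarterMean, intervalIntegral.integral_const_mul, mul_left_comm]

theorem aD_eq_upperDualPeriod {z : ℂ} (hz : 0 ≤ z.im) : aD z = upperDualPeriod ((z + 1) / 2) := by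
  set ζ : ℂ := (z + 1) / 2 with hζ
  have him : 0 ≤ ζ.im := by
    have : ζ.im = z.im / 2 := by rw [hζ]; simp
    rw [this]; positivity
  have hpi' : (Real.pi : ℂ) ≠ 0 := ofReal_ne_zero.2 Real.pi_pos.ne'
  have e1 : (1 - z) / 2 = 1 - ζ := by rw [hζ]; ring
  have e2 : (z - 1) / 2 = ζ - 1 := by rw [hζ]; ring
  have hG : Complex.Gamma (2 - 1 / 2) = 1 / 2 * Complex.Gamma (1 / 2) := by
    rw [← Complex.Gamma_add_one _ (by norm_num)]; norm_num
  have hG2 : Complex.Gamma 2 = 1 := by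
    rw [← one_add_one_eq_two, Complex.Gamma_add_one _ one_ne_zero, Complex.Gamma_one, mul_one]
  rw [aD, hypergeom, e1, e2, integral_dual_integrand him, hG, hG2, upperDualPeriod]
  have h3 : Complex.Gamma (1 / 2) * (1 / 2 * Complex.Gamma (1 / 2)) = Real.pi / 2 := by
    linear_combination (1 / 2) * Gamma_half_mul_Gamma_half
  rw [h3]
  have h4 : (quarterMean fun θ =>
      (ζ - 1) / (1 + upperSqrt (1 - (Real.sin θ ^ 2 : ℝ) + ζ * (Real.sin θ ^ 2 : ℝ)))) =
      (ζ - 1) * quarterMean fun θ =>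
      1 / (1 + upperSqrt (1 - (Real.sin θ ^ 2 : ℝ) + ζ * (Real.sin θ ^ 2 : ℝ))) := by
    rw [← quarterMean_const_mul]
    simp only [mul_one_div]
  rw [h4]
  field_simp

/-! ### Conjugation symmetry of the periods. -/

theorem hypergeom_conj {a b c x : ℂ} (ha : conj a = a) (hb : conj b = b) (hc : conj c = c)
    (hx : x.im ≠ 0) : hypergeom a b c (conj x) = conj (hypergeom a b c x) := by
  simp only [hypergeom, map_mul, map_div₀, ← Complex.Gamma_conj, map_sub, hb, hc]
  congr 1
  rw [intervalIntegral.integral_of_le zero_le_one, intervalIntegral.integral_of_le zero_le_one,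
    ← integral_conj]
  refine setIntegral_congr_fun measurableSet_Ioc fun t ht => ?_
  have h1 : (t : ℂ).arg ≠ Real.pi := by
    rw [arg_ofReal_of_nonneg ht.1.le]; exact Real.pi_pos.ne
  have h2 : (1 - (t : ℂ)).arg ≠ Real.pi := by
    have : (1 : ℂ) - t = ((1 - t : ℝ) : ℂ) := by push_cast; ring
    rw [this, arg_ofReal_of_nonneg (by linarith [ht.2])]; exact Real.pi_pos.ne
  have h3 : (1 - x * (t : ℂ)).arg ≠ Real.pi := by
    intro h
    have := (arg_eq_pi_iff.1 h).2
    simp only [sub_im, one_im, mul_im, ofReal_re, ofReal_im, mul_zero, zero_add, zero_sub,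
      neg_eq_zero, mul_eq_zero] at this
    exact this.elim hx ht.1.ne'
  have e1 := conj_cpow (t : ℂ) (b - 1) h1
  have e2 := conj_cpow (1 - (t : ℂ)) (c - b - 1) h2
  have e3 := conj_cpow (1 - x * (t : ℂ)) (-a) h3
  simp only [map_sub, map_neg, map_mul, map_one, conj_ofReal, ha, hb, hc] at e1 e2 e3
  simp only [map_mul]
  rw [e3, ← e1, ← e2]

theorem a_conj {z : ℂ} (hz : z.im ≠ 0) : a (conj z) = conj (a z) := by
  have h1 : z ≠ -1 := by rintro rfl; simp at hz
  have h2 : conj z ≠ -1 := by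
    intro h; apply h1; simpa using congrArg conj h
  have h3 : (2 / (z + 1)).im ≠ 0 := by
    have h0 : normSq (z + 1) ≠ 0 := by
      rw [Ne, normSq_eq_zero]; intro h; exact h1 (by linear_combination h)
    simp [div_im, hz, h0]
  have h4 : ((z + 1) / 2).arg ≠ Real.pi := by
    intro h
    have := (arg_eq_pi_iff.1 h).2
    simp [hz] at this
  have e := conj_cpow _ (1 / 2 : ℂ) h4
  have f := hypergeom_conj (a := -1 / 2) (b := 1 / 2) (c := 1)
    (by simp [map_ofNat]) (by simp [map_ofNat]) (by simp) h3
  rw [a, a, if_neg h1, if_neg h2]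
  simp only [map_mul, map_div₀, map_add, map_one, map_ofNat] at e f ⊢
  rw [e, f]

theorem aD_conj {z : ℂ} (hz : z.im ≠ 0) : aD (conj z) = -conj (aD z) := by
  have f := hypergeom_conj (a := 1 / 2) (b := 1 / 2) (c := 2) (x := (1 - z) / 2)
    (by simp [map_ofNat]) (by simp [map_ofNat]) (map_ofNat _ 2) (by simpa using hz)
  simp only [aD, map_mul, map_div₀, map_sub, map_one, map_ofNat, conj_I] at f ⊢
  rw [f]
  ring

/-! ### Signs of means and of the periods. -/

theorem quarterMean_re {g : ℝ → ℂ} (hg : Continuous g) :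
    (quarterMean g).re = 2 / Real.pi * ∫ θ in (0 : ℝ)..Real.pi / 2, (g θ).re := by
  rw [quarterMean, re_ofReal_mul]
  congr 1
  exact (intervalIntegral.intervalIntegral_re (hg.intervalIntegrable _ _)).symm

theorem quarterMean_im {g : ℝ → ℂ} (hg : Continuous g) :
    (quarterMean g).im = 2 / Real.pi * ∫ θ in (0 : ℝ)..Real.pi / 2, (g θ).im := by
  rw [quarterMean, im_ofReal_mul]
  congr 1
  exact (intervalIntegral.intervalIntegral_im (hg.intervalIntegrable _ _)).symm

theorem quarterMean_re_nonneg {g : ℝ → ℂ} (hg : Continuous g) (h : ∀ θ, 0 ≤ (g θ).re) :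
    0 ≤ (quarterMean g).re := by
  have hpi := Real.pi_pos
  rw [quarterMean_re hg]
  exact mul_nonneg (by positivity)
    (intervalIntegral.integral_nonneg (by positivity) fun θ _ => h θ)

theorem quarterMean_im_nonneg {g : ℝ → ℂ} (hg : Continuous g) (h : ∀ θ, 0 ≤ (g θ).im) :
    0 ≤ (quarterMean g).im := by
  have hpi := Real.pi_pos
  rw [quarterMean_im hg]
  exact mul_nonneg (by positivity)
    (intervalIntegral.integral_nonneg (by positivity) fun θ _ => h θ)

theorem quarterMean_re_pos {g : ℝ → ℂ} (hg : Continuous g) (h : ∀ θ, 0 ≤ (g θ).re)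
    (h' : ∃ θ ∈ Icc 0 (Real.pi / 2), 0 < (g θ).re) : 0 < (quarterMean g).re := by
  have hpi := Real.pi_pos
  rw [quarterMean_re hg]
  exact mul_pos (by positivity) (intervalIntegral.integral_pos (by positivity)
    (continuous_re.comp hg).continuousOn (fun θ _ => h θ) h')

theorem quarterMean_neg (g : ℝ → ℂ) : (quarterMean fun θ => -g θ) = -quarterMean g := by
  simpa using quarterMean_const_mul (-1) g

theorem quarterMean_sub {f g : ℝ → ℂ} (hf : Continuous f) (hg : Continuous g) :
    (quarterMean fun θ => f θ - g θ) = quarterMean f - quarterMean g := by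
  rw [quarterMean, quarterMean, quarterMean, intervalIntegral.integral_sub
    (hf.intervalIntegrable _ _) (hg.intervalIntegrable _ _), mul_sub]

theorem quarterMean_im_nonpos {g : ℝ → ℂ} (hg : Continuous g) (h : ∀ θ, (g θ).im ≤ 0) :
    (quarterMean g).im ≤ 0 := by
  have := quarterMean_im_nonneg hg.neg fun θ => by simpa using h θ
  rw [Pi.neg_def, quarterMean_neg, neg_im] at this
  linarith

theorem quarterMean_im_neg {g : ℝ → ℂ} (hg : Continuous g) (h : ∀ θ, (g θ).im ≤ 0)
    (h' : ∃ θ ∈ Icc 0 (Real.pi / 2), (g θ).im < 0) : (quarterMean g).im < 0 := by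
  have := quarterMean_re_pos (g := fun θ => I * g θ) (by fun_prop) (fun θ => by simpa using h θ)
    (by simpa using h')
  rw [quarterMean_const_mul] at this
  simpa using this

theorem continuous_upperPeriod_integrand (ζ : ℂ) :
    Continuous fun θ : ℝ => upperSqrt (ζ - (Real.sin θ ^ 2 : ℝ)) :=
  continuous_upperSqrt.comp (by fun_prop)

/-- The square root in the integrand of the dual period. -/
def dualRoot (ζ : ℂ) (θ : ℝ) : ℂ :=
  upperSqrt (1 - (Real.sin θ ^ 2 : ℝ) + ζ * (Real.sin θ ^ 2 : ℝ))

theorem continuous_dualRoot (ζ : ℂ) : Continuous (dualRoot ζ) :=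
  continuous_upperSqrt.comp (by fun_prop)

theorem dualRoot_sq {ζ : ℂ} (hζ : 0 ≤ ζ.im) (θ : ℝ) :
    dualRoot ζ θ ^ 2 = 1 + (ζ - 1) * (Real.sin θ ^ 2 : ℝ) := by
  rw [dualRoot, upperSqrt_sq (dual_radicand_im_nonneg hζ (sq_nonneg _))]
  ring

theorem dualRoot_of_sin_eq_zero (ζ : ℂ) {θ : ℝ} (h : Real.sin θ = 0) : dualRoot ζ θ = 1 := by
  have := upperSqrt_ofReal_of_nonneg zero_le_one
  simpa [dualRoot, h] using this

theorem dualRoot_re_nonneg (ζ : ℂ) (θ : ℝ) : 0 ≤ (dualRoot ζ θ).re := upperSqrt_re_nonneg _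

theorem dualRoot_im_nonneg (ζ : ℂ) (θ : ℝ) : 0 ≤ (dualRoot ζ θ).im := upperSqrt_im_nonneg _

theorem upperDualPeriod_eq (ζ : ℂ) : upperDualPeriod ζ =
    2 * I * quarterMean fun θ => (ζ - 1) / (1 + dualRoot ζ θ) := rfl

theorem continuous_dualPeriod_integrand (ζ : ℂ) :
    Continuous fun θ => (ζ - 1) / (1 + dualRoot ζ θ) :=
  continuous_const.div (continuous_const.add (continuous_dualRoot ζ))
    fun _ => one_add_upperSqrt_ne_zero _

/-- Rationalisation: (ζ - 1) sin²θ = (Q - 1)(Q + 1) for the root Q. The quotient form of the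
integrand stays regular where sin θ = 0. -/
theorem sin_sq_mul_dualPeriod_integrand {ζ : ℂ} (hζ : 0 ≤ ζ.im) (θ : ℝ) :
    ((Real.sin θ ^ 2 : ℝ) : ℂ) * ((ζ - 1) / (1 + dualRoot ζ θ)) = dualRoot ζ θ - 1 := by
  have h := dualRoot_sq hζ θ
  have h1 : 1 + dualRoot ζ θ ≠ 0 := one_add_upperSqrt_ne_zero _
  field_simp
  linear_combination -h

theorem upperPeriod_re_nonneg (ζ : ℂ) : 0 ≤ (upperPeriod ζ).re :=
  quarterMean_re_nonneg (continuous_upperPeriod_integrand ζ) fun _ => upperSqrt_re_nonneg _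

theorem upperPeriod_im_nonneg (ζ : ℂ) : 0 ≤ (upperPeriod ζ).im :=
  quarterMean_im_nonneg (continuous_upperPeriod_integrand ζ) fun _ => upperSqrt_im_nonneg _

theorem upperPeriod_re_pos {ζ : ℂ} (hζ : 0 < ζ.im) : 0 < (upperPeriod ζ).re :=
  quarterMean_re_pos (continuous_upperPeriod_integrand ζ) (fun _ => upperSqrt_re_nonneg _)
    ⟨0, ⟨le_rfl, by positivity⟩, upperSqrt_re_pos (by simpa using hζ.le)
      (Or.inl (by simpa using hζ))⟩

theorem upperDualPeriod_re (ζ : ℂ) : (upperDualPeriod ζ).re =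
    -(2 * (quarterMean fun θ => (ζ - 1) / (1 + dualRoot ζ θ)).im) := by
  rw [upperDualPeriod_eq]; simp

theorem upperDualPeriod_im (ζ : ℂ) : (upperDualPeriod ζ).im =
    2 * (quarterMean fun θ => (ζ - 1) / (1 + dualRoot ζ θ)).re := by
  rw [upperDualPeriod_eq]; simp

theorem dualPeriod_integrand_of_sin_eq_zero (ζ : ℂ) {θ : ℝ} (h : Real.sin θ = 0) :
    (ζ - 1) / (1 + dualRoot ζ θ) = (((1 / 2 : ℝ)) : ℂ) * (ζ - 1) := by
  rw [dualRoot_of_sin_eq_zero ζ h]; push_cast; ring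

theorem dualPeriod_integrand_im_nonneg {ζ : ℂ} (hζ : 0 ≤ ζ.im) (θ : ℝ) :
    0 ≤ ((ζ - 1) / (1 + dualRoot ζ θ)).im := by
  rcases eq_or_ne (Real.sin θ) 0 with h | h
  · rw [dualPeriod_integrand_of_sin_eq_zero ζ h, im_ofReal_mul]
    simpa using hζ
  · have := congrArg Complex.im (sin_sq_mul_dualPeriod_integrand hζ θ)
    rw [im_ofReal_mul, sub_im, one_im, sub_zero] at this
    have h2 : 0 < Real.sin θ ^ 2 := by positivity
    have h3 := dualRoot_im_nonneg ζ θ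
    rw [← this] at h3
    exact nonneg_of_mul_nonneg_right h3 h2

theorem upperDualPeriod_re_nonpos {ζ : ℂ} (hζ : 0 ≤ ζ.im) : (upperDualPeriod ζ).re ≤ 0 := by
  rw [upperDualPeriod_re]
  linarith [quarterMean_im_nonneg (continuous_dualPeriod_integrand ζ)
    (dualPeriod_integrand_im_nonneg hζ)]

/-! ### Positivity of the form on differences. -/

theorem one_div_re (w : ℂ) : (1 / w).re = w.re / normSq w := by simp [inv_re]

theorem one_div_im (w : ℂ) : (1 / w).im = -w.im / normSq w := by simp [inv_im]

/-- Two distinct points of the closed upper half plane have period vectors whose difference is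
positive for the hermitian form `Im (conj a * a_D)`. -/
theorem upperPeriods_difference_pos {ζ ζ₀ : ℂ} (hζ : 0 ≤ ζ.im) (hζ₀ : 0 ≤ ζ₀.im) (hne : ζ ≠ ζ₀) :
    0 < (conj (upperPeriod ζ - upperPeriod ζ₀) *
      (upperDualPeriod ζ - upperDualPeriod ζ₀)).im := by
  set s : ℝ → ℂ := fun θ => upperSqrt (ζ - (Real.sin θ ^ 2 : ℝ)) +
    upperSqrt (ζ₀ - (Real.sin θ ^ 2 : ℝ)) with hs
  set d : ℝ → ℂ := fun θ => dualRoot ζ θ + dualRoot ζ₀ θ with hd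
  have hsre : ∀ θ, 0 ≤ (s θ).re := fun θ =>
    add_nonneg (upperSqrt_re_nonneg _) (upperSqrt_re_nonneg _)
  have hsim : ∀ θ, 0 ≤ (s θ).im := fun θ =>
    add_nonneg (upperSqrt_im_nonneg _) (upperSqrt_im_nonneg _)
  have hdre : ∀ θ, 0 ≤ (d θ).re := fun θ =>
    add_nonneg (dualRoot_re_nonneg _ _) (dualRoot_re_nonneg _ _)
  have hdim : ∀ θ, 0 ≤ (d θ).im := fun θ =>
    add_nonneg (dualRoot_im_nonneg _ _) (dualRoot_im_nonneg _ _)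
  have hrad : ∀ {ξ : ℂ}, 0 ≤ ξ.im → ∀ θ : ℝ, 0 ≤ (ξ - (Real.sin θ ^ 2 : ℝ)).im := by
    intro ξ hξ θ
    rwa [sub_im, ofReal_im, sub_zero]
  -- A sum of two points of the closed first quadrant vanishes only if both do; then both radicands
  -- vanish and ζ = ζ₀.
  have hs0 : ∀ θ, s θ ≠ 0 := by
    intro θ h
    have h1 := congrArg Complex.re h
    have h2 := congrArg Complex.im h
    simp only [hs, add_re, add_im, zero_re, zero_im] at h1 h2
    have a1 := upperSqrt_re_nonneg (ζ - (Real.sin θ ^ 2 : ℝ))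
    have a2 := upperSqrt_im_nonneg (ζ - (Real.sin θ ^ 2 : ℝ))
    have a3 := upperSqrt_re_nonneg (ζ₀ - (Real.sin θ ^ 2 : ℝ))
    have a4 := upperSqrt_im_nonneg (ζ₀ - (Real.sin θ ^ 2 : ℝ))
    have e1 := (upperSqrt_eq_zero (hrad hζ θ)).1
      (Complex.ext (by rw [zero_re]; linarith) (by rw [zero_im]; linarith))
    have e2 := (upperSqrt_eq_zero (hrad hζ₀ θ)).1
      (Complex.ext (by rw [zero_re]; linarith) (by rw [zero_im]; linarith))
    exact hne (by linear_combination e1 - e2)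
  have hd0 : ∀ θ, d θ ≠ 0 := by
    intro θ h
    have h1 := congrArg Complex.re h
    have h2 := congrArg Complex.im h
    simp only [hd, add_re, add_im, zero_re, zero_im] at h1 h2
    have a1 := dualRoot_re_nonneg ζ θ
    have a2 := dualRoot_im_nonneg ζ θ
    have a3 := dualRoot_re_nonneg ζ₀ θ
    have a4 := dualRoot_im_nonneg ζ₀ θ
    have z1 : dualRoot ζ θ = 0 :=
      Complex.ext (by rw [zero_re]; linarith) (by rw [zero_im]; linarith)
    have z2 : dualRoot ζ₀ θ = 0 :=
      Complex.ext (by rw [zero_re]; linarith) (by rw [zero_im]; linarith)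
    have e1 := dualRoot_sq hζ θ
    have e2 := dualRoot_sq hζ₀ θ
    rw [z1] at e1
    rw [z2] at e2
    have hsin : ((Real.sin θ ^ 2 : ℝ) : ℂ) ≠ 0 := by
      intro h0; rw [h0] at e1; simp at e1
    have : (ζ - ζ₀) * ((Real.sin θ ^ 2 : ℝ) : ℂ) = 0 := by linear_combination e2 - e1
    exact hne (sub_eq_zero.1 ((mul_eq_zero.1 this).resolve_right hsin))
  have hsc : Continuous fun θ => 1 / s θ := continuous_const.div
    ((continuous_upperPeriod_integrand ζ).add (continuous_upperPeriod_integrand ζ₀)) hs0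
  have hdc : Continuous fun θ => 1 / d θ := continuous_const.div
    ((continuous_dualRoot ζ).add (continuous_dualRoot ζ₀)) hd0
  have hA : upperPeriod ζ - upperPeriod ζ₀ = (ζ - ζ₀) * quarterMean fun θ => 1 / s θ := by
    rw [upperPeriod, upperPeriod, ← quarterMean_sub (continuous_upperPeriod_integrand ζ)
      (continuous_upperPeriod_integrand ζ₀), ← quarterMean_const_mul]
    congr 1
    funext θ
    rw [mul_one_div, eq_div_iff (hs0 θ)]
    simp only [hs]
    linear_combination upperSqrt_sq (hrad hζ θ) - upperSqrt_sq (hrad hζ₀ θ)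
  have hD : upperDualPeriod ζ - upperDualPeriod ζ₀ =
      2 * I * ((ζ - ζ₀) * quarterMean fun θ => 1 / d θ) := by
    rw [upperDualPeriod_eq, upperDualPeriod_eq, ← mul_sub,
      ← quarterMean_sub (continuous_dualPeriod_integrand ζ) (continuous_dualPeriod_integrand ζ₀),
      ← quarterMean_const_mul (ζ - ζ₀)]
    congr 2
    funext θ
    rcases eq_or_ne (Real.sin θ) 0 with h | h
    · simp only [hd, dualRoot_of_sin_eq_zero _ h]; ring
    · have hsin : ((Real.sin θ ^ 2 : ℝ) : ℂ) ≠ 0 := ofReal_ne_zero.2 (pow_ne_zero 2 h)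
      refine mul_left_cancel₀ hsin ?_
      rw [mul_sub, sin_sq_mul_dualPeriod_integrand hζ, sin_sq_mul_dualPeriod_integrand hζ₀,
        mul_one_div, mul_div_assoc', eq_div_iff (hd0 θ)]
      simp only [hd]
      linear_combination dualRoot_sq hζ θ - dualRoot_sq hζ₀ θ
  set A := quarterMean fun θ => 1 / s θ with hAdef
  set D := quarterMean fun θ => 1 / d θ with hDdef
  have pA : ∀ θ, 0 ≤ (1 / s θ).re := fun θ => by
    rw [one_div_re]; exact div_nonneg (hsre θ) (normSq_nonneg _)
  have pA' : ∀ θ, (1 / s θ).im ≤ 0 := fun θ => by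
    rw [one_div_im]
    exact div_nonpos_of_nonpos_of_nonneg (neg_nonpos.2 (hsim θ)) (normSq_nonneg _)
  have pD : ∀ θ, 0 ≤ (1 / d θ).re := fun θ => by
    rw [one_div_re]; exact div_nonneg (hdre θ) (normSq_nonneg _)
  have pD' : ∀ θ, (1 / d θ).im ≤ 0 := fun θ => by
    rw [one_div_im]
    exact div_nonpos_of_nonpos_of_nonneg (neg_nonpos.2 (hdim θ)) (normSq_nonneg _)
  have hpi := Real.pi_pos
  have m0 : (0 : ℝ) ∈ Icc 0 (Real.pi / 2) := ⟨le_rfl, by positivity⟩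
  have m1 : Real.pi / 2 ∈ Icc 0 (Real.pi / 2) := ⟨by positivity, le_rfl⟩
  have hDre : 0 < D.re := by
    refine quarterMean_re_pos hdc pD ⟨0, m0, ?_⟩
    simp [hd, dualRoot_of_sin_eq_zero _ Real.sin_zero]
  have hAre := quarterMean_re_nonneg hsc pA
  have hAim := quarterMean_im_nonpos hsc pA'
  have hDim := quarterMean_im_nonpos hdc pD'
  -- Both products are nonnegative. If ζ or ζ₀ lies off (-∞, 0], the value at θ = 0 makes the first
  -- positive. Otherwise the value at θ = π/2 makes the second positive, since ζ and ζ₀ are not both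
  -- 0.
  have key : 0 < A.re * D.re + A.im * D.im := by
    by_cases hc : (0 < ζ.im ∨ 0 < ζ.re) ∨ (0 < ζ₀.im ∨ 0 < ζ₀.re)
    · have hpos : 0 < A.re := by
        refine quarterMean_re_pos hsc pA ⟨0, m0, ?_⟩
        rw [one_div_re]
        refine div_pos ?_ (normSq_pos.2 (hs0 0))
        simp only [hs, Real.sin_zero, ne_eq, OfNat.ofNat_ne_zero, not_false_eq_true, zero_pow,
          ofReal_zero, sub_zero, add_re]
        rcases hc with hc | hc
        · exact add_pos_of_pos_of_nonneg (upperSqrt_re_pos hζ hc) (upperSqrt_re_nonneg _)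
        · exact add_pos_of_nonneg_of_pos (upperSqrt_re_nonneg _) (upperSqrt_re_pos hζ₀ hc)
      nlinarith [mul_pos hpos hDre, mul_nonneg_of_nonpos_of_nonpos hAim hDim]
    · push Not at hc
      obtain ⟨⟨h1, h2⟩, h3, h4⟩ := hc
      have hAneg : A.im < 0 := by
        refine quarterMean_im_neg hsc pA' ⟨Real.pi / 2, m1, ?_⟩
        rw [one_div_im]
        refine div_neg_of_neg_of_pos (neg_neg_of_pos ?_) (normSq_pos.2 (hs0 _))
        simp only [hs, Real.sin_pi_div_two, one_pow, ofReal_one, add_im]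
        refine add_pos_of_pos_of_nonneg (upperSqrt_im_pos (by simpa using hζ) (Or.inr ?_))
          (upperSqrt_im_nonneg _)
        simp; linarith
      have hDneg : D.im < 0 := by
        refine quarterMean_im_neg hdc pD' ⟨Real.pi / 2, m1, ?_⟩
        rw [one_div_im]
        refine div_neg_of_neg_of_pos (neg_neg_of_pos ?_) (normSq_pos.2 (hd0 _))
        simp only [hd, dualRoot, Real.sin_pi_div_two, one_pow, ofReal_one, add_im, sub_self,
          zero_add, mul_one]
        rcases eq_or_lt_of_le h2 with h | h
        · refine add_pos_of_nonneg_of_pos (upperSqrt_im_nonneg _) (upperSqrt_im_pos hζ₀ (Or.inr ?_))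
          refine h4.lt_of_ne fun h' => hne ?_
          apply Complex.ext <;> linarith
        · exact add_pos_of_pos_of_nonneg (upperSqrt_im_pos hζ (Or.inr h)) (upperSqrt_im_nonneg _)
      nlinarith [mul_nonneg hAre hDre.le, mul_pos_of_neg_of_neg hAneg hDneg]
  have hform : (conj (upperPeriod ζ - upperPeriod ζ₀) *
      (upperDualPeriod ζ - upperDualPeriod ζ₀)).im =
      2 * normSq (ζ - ζ₀) * (A.re * D.re + A.im * D.im) := by
    rw [hA, hD, normSq_apply]
    generalize ζ - ζ₀ = δ
    simp
    ring
  rw [hform]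
  have : 0 < normSq (ζ - ζ₀) := normSq_pos.2 (sub_ne_zero.2 hne)
  positivity

theorem conj_mul_im (v w : ℂ) : (conj v * w).im = v.re * w.im - v.im * w.re := by
  simp; ring

/-! ### Where the form can be negative. -/

/-- The hermitian form `Im (conj a * a_D)` of the period vector on the closed upper half plane. -/
def upperForm (ζ : ℂ) : ℝ := (conj (upperPeriod ζ) * upperDualPeriod ζ).im

theorem upperForm_eq (ζ : ℂ) : upperForm ζ = (upperPeriod ζ).re * (upperDualPeriod ζ).im -
    (upperPeriod ζ).im * (upperDualPeriod ζ).re := conj_mul_im _ _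

theorem continuous_upperPeriod : Continuous upperPeriod := by
  refine continuous_const.mul
    (intervalIntegral.continuous_parametric_intervalIntegral_of_continuous' ?_ _ _)
  exact continuous_upperSqrt.comp (by fun_prop)

theorem continuous_upperDualPeriod : Continuous upperDualPeriod := by
  refine continuous_const.mul (continuous_const.mul
    (intervalIntegral.continuous_parametric_intervalIntegral_of_continuous' ?_ _ _))
  refine Continuous.div (by fun_prop) (continuous_const.add (continuous_upperSqrt.comp ?_))
    fun _ => one_add_upperSqrt_ne_zero _
  fun_prop

theorem continuous_upperForm : Continuous upperForm :=
  continuous_im.comp ((continuous_conj.comp continuous_upperPeriod).mul continuous_upperDualPeriod)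

theorem upperForm_nonneg_of_dual_im_nonneg {ζ : ℂ} (hζ : 0 ≤ ζ.im)
    (h : 0 ≤ (upperDualPeriod ζ).im) : 0 ≤ upperForm ζ := by
  rw [upperForm_eq]
  have h1 := mul_nonneg (upperPeriod_re_nonneg ζ) h
  have h2 := mul_nonneg_of_nonpos_of_nonpos (neg_nonpos.2 (upperPeriod_im_nonneg ζ))
    (upperDualPeriod_re_nonpos hζ)
  linarith

theorem upperDualPeriod_im_nonneg_of_one_le_re {ζ : ℂ} (hζ : 0 ≤ ζ.im) (h : 1 ≤ ζ.re) :
    0 ≤ (upperDualPeriod ζ).im := by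
  rw [upperDualPeriod_im]
  refine mul_nonneg zero_le_two
    (quarterMean_re_nonneg (continuous_dualPeriod_integrand ζ) fun θ => ?_)
  have h1 := dualRoot_re_nonneg ζ θ
  have h2 := dualRoot_im_nonneg ζ θ
  rw [div_re, ← add_div]
  refine div_nonneg (add_nonneg (mul_nonneg ?_ ?_) (mul_nonneg ?_ ?_)) (normSq_nonneg _) <;>
    simp <;> linarith

theorem dualRoot_re_im {ζ : ℂ} (hζ : 0 ≤ ζ.im) (θ : ℝ) :
    (dualRoot ζ θ).re * (dualRoot ζ θ).re - (dualRoot ζ θ).im * (dualRoot ζ θ).im =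
      1 + (ζ.re - 1) * Real.sin θ ^ 2 ∧
    2 * ((dualRoot ζ θ).re * (dualRoot ζ θ).im) = ζ.im * Real.sin θ ^ 2 := by
  have h := dualRoot_sq hζ θ
  have h1 := congrArg Complex.re h
  have h2 := congrArg Complex.im h
  simp only [sq (dualRoot ζ θ), mul_re, mul_im, add_re, add_im, one_re, one_im, sub_re, sub_im,
    ofReal_re, ofReal_im] at h1 h2
  constructor <;> linarith

theorem upperDualPeriod_im_nonneg_of_le_im {ζ : ℂ} (hre : 0 ≤ ζ.re) (h : 16 ≤ ζ.im) :
    0 ≤ (upperDualPeriod ζ).im := by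
  have hζ : 0 ≤ ζ.im := by linarith
  have hpi := Real.pi_pos
  -- The lower bound has mean zero over the quarter period.
  have hpt : ∀ θ, 2 * Real.sin θ ^ 2 - 1 ≤ ((ζ - 1) / (1 + dualRoot ζ θ)).re := by
    intro θ
    rcases eq_or_ne (Real.sin θ) 0 with h0 | h0
    · rw [dualPeriod_integrand_of_sin_eq_zero ζ h0, h0, re_ofReal_mul, sub_re, one_re]
      linarith
    · have e := congrArg Complex.re (sin_sq_mul_dualPeriod_integrand hζ θ)
      rw [re_ofReal_mul, sub_re, one_re] at e
      obtain ⟨e1, e2⟩ := dualRoot_re_im hζ θ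
      have hX := dualRoot_re_nonneg ζ θ
      have hY := dualRoot_im_nonneg ζ θ
      have ht : 0 < Real.sin θ ^ 2 := by positivity
      have ht1 := Real.sin_sq_le_one θ
      generalize Real.sin θ ^ 2 = t at *
      generalize (dualRoot ζ θ).re = X at *
      generalize (dualRoot ζ θ).im = Y at *
      refine le_of_mul_le_mul_left ?_ ht
      rw [e]
      -- With t = sin²θ, a small X forces Y ≥ 4t through XY = t Im ζ / 2, and then X² = Y² + 1 + (Re
      -- ζ - 1)t is too large. The threshold 16 is not sharp.
      by_contra! hlt
      have hX2 : X ≤ 2 := by nlinarith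
      have hXY : 8 * t ≤ X * Y := by nlinarith
      have hY2 : 4 * t ≤ Y := by nlinarith
      have hYY : 16 * (t * t) ≤ Y * Y := by nlinarith
      have hg : X * X < (1 - t + 2 * t ^ 2) * (1 - t + 2 * t ^ 2) :=
        mul_self_lt_mul_self hX (by linarith)
      have hb : t ^ 4 ≤ t ^ 2 := pow_le_pow_of_le_one ht.le ht1 (by norm_num)
      nlinarith [mul_nonneg hre ht.le, pow_pos ht 3]
  rw [upperDualPeriod_im, quarterMean_re (continuous_dualPeriod_integrand ζ)]
  have hint : (∫ θ in (0 : ℝ)..Real.pi / 2, (2 * Real.sin θ ^ 2 - 1)) = 0 := by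
    rw [intervalIntegral.integral_sub (Continuous.intervalIntegrable (by fun_prop) _ _)
      (Continuous.intervalIntegrable (by fun_prop) _ _), intervalIntegral.integral_const_mul,
      integral_sin_sq]
    simp
    ring
  have hmono := intervalIntegral.integral_mono (a := 0) (b := Real.pi / 2) (μ := volume)
    (by positivity) (Continuous.intervalIntegrable (by fun_prop) _ _)
    ((continuous_re.comp (continuous_dualPeriod_integrand ζ)).intervalIntegrable _ _) hpt
  rw [hint] at hmono
  have hmono' : 0 ≤ ∫ θ in (0 : ℝ)..Real.pi / 2, ((ζ - 1) / (1 + dualRoot ζ θ)).re := hmono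
  positivity

/-- The inequality holds pointwise between the integrands once θ is replaced by π/2 - θ in the
first. -/
theorem two_mul_upperPeriod_re_le {ζ : ℂ} (hζ : 0 ≤ ζ.im) (hre : ζ.re ≤ 0) :
    2 * (upperPeriod ζ).re ≤ -(upperDualPeriod ζ).re := by
  have hpi := Real.pi_pos
  have hpt : ∀ θ, (upperSqrt (ζ - (Real.sin (Real.pi / 2 - θ) ^ 2 : ℝ))).re ≤
      ((ζ - 1) / (1 + dualRoot ζ θ)).im := by
    intro θ
    have hw : 0 ≤ (ζ - (Real.sin (Real.pi / 2 - θ) ^ 2 : ℝ)).im := by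
      rwa [sub_im, ofReal_im, sub_zero]
    have f1 := upperSqrt_re_sq_sub_im_sq hw
    have f2 := two_mul_upperSqrt_re_mul_im hw
    have hA := upperSqrt_re_nonneg (ζ - (Real.sin (Real.pi / 2 - θ) ^ 2 : ℝ))
    have hB := upperSqrt_im_nonneg (ζ - (Real.sin (Real.pi / 2 - θ) ^ 2 : ℝ))
    generalize (upperSqrt (ζ - (Real.sin (Real.pi / 2 - θ) ^ 2 : ℝ))).re = A at *
    generalize (upperSqrt (ζ - (Real.sin (Real.pi / 2 - θ) ^ 2 : ℝ))).im = B at *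
    rw [sub_re, ofReal_re, Real.sin_pi_div_two_sub, Real.cos_sq'] at f1
    rw [sub_im, ofReal_im, sub_zero] at f2
    rcases eq_or_ne (Real.sin θ) 0 with h0 | h0
    · rw [dualPeriod_integrand_of_sin_eq_zero ζ h0, im_ofReal_mul, sub_im, one_im, sub_zero]
      rw [h0] at f1
      have hB1 : 1 ≤ B := by nlinarith
      nlinarith
    · have e := congrArg Complex.im (sin_sq_mul_dualPeriod_integrand hζ θ)
      rw [im_ofReal_mul, sub_im, one_im, sub_zero] at e
      obtain ⟨e1, e2⟩ := dualRoot_re_im hζ θ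
      have hX := dualRoot_re_nonneg ζ θ
      have hY := dualRoot_im_nonneg ζ θ
      have ht : 0 < Real.sin θ ^ 2 := by positivity
      have ht1 := Real.sin_sq_le_one θ
      generalize Real.sin θ ^ 2 = t at *
      generalize (dualRoot ζ θ).re = X at *
      generalize (dualRoot ζ θ).im = Y at *
      refine le_of_mul_le_mul_left ?_ ht
      rw [e]
      have hXY : X * Y = t * (A * B) := by linear_combination e2 / 2 - t * f2 / 2
      -- Adding the two real-part identities gives X² - Y² + A² - B² = (1 + t) Re ζ ≤ 0. So B < X
      -- would give A < Y, hence AB < XY = tAB ≤ AB.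
      have hXB : X ≤ B := by
        by_contra! hlt
        have h1 : A * A < Y * Y := by nlinarith
        have h2 : A < Y := lt_of_mul_self_lt_mul_self₀ hY h1
        have h3 : A * B < X * Y := by nlinarith
        nlinarith [mul_nonneg hA hB]
      rcases eq_or_lt_of_le hX with h | h
      · have hAB : A * B = 0 := by
          rw [← h, zero_mul] at hXY
          exact (mul_eq_zero.1 hXY.symm).resolve_left ht.ne'
        have hA0 : A = 0 := by
          rcases mul_eq_zero.1 hAB with h' | h'
          · exact h'
          · rw [h'] at f1
            exact mul_self_eq_zero.1 (le_antisymm (by nlinarith) (mul_self_nonneg A))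
        rw [hA0, mul_zero]
        exact hY
      · refine le_of_mul_le_mul_left ?_ h
        rw [hXY]
        nlinarith [mul_nonneg (mul_nonneg ht.le hA) (sub_nonneg.2 hXB)]
  rw [upperDualPeriod_re, quarterMean_im (continuous_dualPeriod_integrand ζ), upperPeriod,
    quarterMean_re (continuous_upperPeriod_integrand ζ), neg_neg]
  have hsub := intervalIntegral.integral_comp_sub_left (a := 0) (b := Real.pi / 2)
    (fun θ => (upperSqrt (ζ - (Real.sin θ ^ 2 : ℝ))).re) (Real.pi / 2)
  rw [sub_self, sub_zero] at hsub
  rw [← hsub]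
  have hmono := intervalIntegral.integral_mono (a := 0) (b := Real.pi / 2) (μ := volume)
    (by positivity) (((continuous_re.comp (continuous_upperPeriod_integrand ζ)).comp
      (continuous_const.sub continuous_id)).intervalIntegrable _ _)
    ((continuous_im.comp (continuous_dualPeriod_integrand ζ)).intervalIntegrable _ _) hpt
  exact mul_le_mul_of_nonneg_left (mul_le_mul_of_nonneg_left hmono (by positivity)) zero_le_two

theorem upperDualPeriod_zero : upperDualPeriod 0 = -(4 * I / (Real.pi : ℂ)) := by
  have hpi := Real.pi_pos
  have h : ∀ θ ∈ uIcc (0 : ℝ) (Real.pi / 2),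
      (0 - 1) / (1 + dualRoot 0 θ) = ((-(1 / (1 + Real.cos θ)) : ℝ) : ℂ) := by
    intro θ hθ
    rw [uIcc_of_le (by positivity)] at hθ
    have hc : 0 ≤ Real.cos θ := Real.cos_nonneg_of_mem_Icc ⟨by linarith [hθ.1], hθ.2⟩
    have h1 : (1 : ℂ) - (Real.sin θ ^ 2 : ℝ) + 0 * (Real.sin θ ^ 2 : ℝ) =
        ((Real.cos θ ^ 2 : ℝ) : ℂ) := by
      rw [Real.cos_sq']; push_cast; ring
    rw [dualRoot, h1, upperSqrt_ofReal_of_nonneg (sq_nonneg _), Real.sqrt_sq hc]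
    push_cast; ring
  have hint : (∫ θ in (0 : ℝ)..Real.pi / 2, -(1 / (1 + Real.cos θ))) = -1 := by
    have hpos : ∀ θ ∈ uIcc (0 : ℝ) (Real.pi / 2), 1 + Real.cos θ ≠ 0 := by
      intro θ hθ
      rw [uIcc_of_le (by positivity)] at hθ
      have hc : 0 ≤ Real.cos θ := Real.cos_nonneg_of_mem_Icc ⟨by linarith [hθ.1], hθ.2⟩
      positivity
    rw [intervalIntegral.integral_eq_sub_of_hasDerivAt
      (f := fun θ => -(Real.sin θ / (1 + Real.cos θ)))]
    · simp
    · intro θ hθ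
      have hne := hpos θ hθ
      refine HasDerivAt.congr_deriv ((Real.hasDerivAt_sin θ).div
        ((Real.hasDerivAt_cos θ).const_add 1) hne).neg ?_
      field_simp
      linear_combination -Real.sin_sq_add_cos_sq θ
    · refine ContinuousOn.intervalIntegrable (ContinuousOn.neg (ContinuousOn.div
        continuousOn_const (by fun_prop) hpos))
  rw [upperDualPeriod_eq, quarterMean, intervalIntegral.integral_congr h,
    intervalIntegral.integral_ofReal, hint]
  push_cast
  ring

/-- Compare with ζ = 0, where a = ib and a_D = -2ib with b = 2/π, so the form vanishes. Positivity
on the difference reads K(ζ) + b(2 Re a + Re a_D) > 0, and the bracket is nonpositive. -/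
theorem upperForm_nonneg_of_re_nonpos {ζ : ℂ} (hζ : 0 ≤ ζ.im) (hre : ζ.re ≤ 0) :
    0 ≤ upperForm ζ := by
  have hpi := Real.pi_pos
  have ha : upperPeriod 0 = ((2 / Real.pi : ℝ) : ℂ) * I := by
    rw [upperPeriod_zero]; push_cast; ring
  have hD : upperDualPeriod 0 = ((-(2 * (2 / Real.pi)) : ℝ) : ℂ) * I := by
    rw [upperDualPeriod_zero]; push_cast; ring
  rcases eq_or_ne ζ 0 with h | h
  · rw [h, upperForm_eq, ha, hD]; simp
  · have h1 := upperPeriods_difference_pos hζ (by simp) h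
    have h2 := two_mul_upperPeriod_re_le hζ hre
    have hb : 0 < 2 / Real.pi := by positivity
    rw [conj_mul_im, ha, hD] at h1
    rw [upperForm_eq]
    generalize 2 / Real.pi = b at *
    simp at h1
    nlinarith

/-! ### Transfer to the whole plane. -/

/-- The point of the closed upper half plane, in the coordinate `ζ = (z + 1) / 2`, which
corresponds to `z` or to its conjugate. -/
def fold (z : ℂ) : ℂ := ⟨(z.re + 1) / 2, |z.im| / 2⟩

theorem fold_im_nonneg (z : ℂ) : 0 ≤ (fold z).im := by
  simp only [fold]; positivity

theorem continuous_fold : Continuous fold := by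
  have : fold = fun z => equivRealProdCLM.symm ((z.re + 1) / 2, |z.im| / 2) := by
    funext z; apply Complex.ext <;> simp [fold]
  rw [this]
  fun_prop

theorem fold_conj (z : ℂ) : fold (conj z) = fold z := by simp [fold]

theorem fold_of_im_nonneg {z : ℂ} (hz : 0 ≤ z.im) : fold z = (z + 1) / 2 := by
  apply Complex.ext <;> simp [fold, abs_of_nonneg hz]

theorem periods_of_im_nonneg {z : ℂ} (hz : 0 ≤ z.im) :
    a z = upperPeriod (fold z) ∧ aD z = upperDualPeriod (fold z) := by
  rw [fold_of_im_nonneg hz]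
  exact ⟨a_eq_upperPeriod hz, aD_eq_upperDualPeriod hz⟩

theorem periods_of_im_neg {z : ℂ} (hz : z.im < 0) :
    a z = conj (upperPeriod (fold z)) ∧ aD z = -conj (upperDualPeriod (fold z)) := by
  have h : 0 ≤ (conj z).im := by rw [conj_im]; linarith
  have h' : (conj z).im ≠ 0 := by rw [conj_im]; linarith
  obtain ⟨h1, h2⟩ := periods_of_im_nonneg h
  rw [fold_conj] at h1 h2
  rw [← h1, ← h2, ← a_conj h', ← aD_conj h', conj_conj]
  exact ⟨rfl, rfl⟩

theorem form_eq_upperForm_fold (z : ℂ) : (conj (a z) * aD z).im = upperForm (fold z) := by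
  rcases le_or_gt 0 z.im with h | h
  · obtain ⟨h1, h2⟩ := periods_of_im_nonneg h
    rw [h1, h2, upperForm]
  · obtain ⟨h1, h2⟩ := periods_of_im_neg h
    rw [h1, h2, upperForm_eq, conj_mul_im]
    simp

theorem periods_difference_pos {z z₀ : ℂ} (hne : fold z ≠ fold z₀) :
    0 < (conj (a z - a z₀) * (aD z - aD z₀)).im := by
  have h := upperPeriods_difference_pos (fold_im_nonneg z) (fold_im_nonneg z₀) hne
  -- For points on opposite sides of the real axis, the form of the difference exceeds that of the
  -- folded points by twice the sum of these two terms.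
  have y1 := mul_nonneg (upperPeriod_im_nonneg (fold z))
    (neg_nonneg.2 (upperDualPeriod_re_nonpos (fold_im_nonneg z₀)))
  have y2 := mul_nonneg (upperPeriod_im_nonneg (fold z₀))
    (neg_nonneg.2 (upperDualPeriod_re_nonpos (fold_im_nonneg z)))
  rw [conj_mul_im] at h ⊢
  simp only [sub_re, sub_im] at h ⊢
  rcases le_or_gt 0 z.im with hz | hz <;> rcases le_or_gt 0 z₀.im with hz₀ | hz₀
  · obtain ⟨e1, e2⟩ := periods_of_im_nonneg hz
    obtain ⟨e3, e4⟩ := periods_of_im_nonneg hz₀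
    rwa [e1, e2, e3, e4]
  · obtain ⟨e1, e2⟩ := periods_of_im_nonneg hz
    obtain ⟨e3, e4⟩ := periods_of_im_neg hz₀
    rw [e1, e2, e3, e4]
    simp only [conj_re, conj_im, neg_re, neg_im]
    linarith
  · obtain ⟨e1, e2⟩ := periods_of_im_neg hz
    obtain ⟨e3, e4⟩ := periods_of_im_nonneg hz₀
    rw [e1, e2, e3, e4]
    simp only [conj_re, conj_im, neg_re, neg_im]
    linarith
  · obtain ⟨e1, e2⟩ := periods_of_im_neg hz
    obtain ⟨e3, e4⟩ := periods_of_im_neg hz₀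
    rw [e1, e2, e3, e4]
    simp only [conj_re, conj_im, neg_re, neg_im]
    linarith

theorem mem_marginalCurve_iff (z : ℂ) : z ∈ marginalCurve ↔ upperForm (fold z) = 0 := by
  have h : (aD z / a z).im = (conj (a z) * aD z).im / normSq (a z) := by
    rw [conj_mul_im, div_im]; ring
  rw [← form_eq_upperForm_fold, marginalCurve, mem_ofPred_eq, h, div_eq_zero_iff]
  -- Where a = 0, division by zero puts the point on the curve, and the form vanishes there too.
  refine ⟨fun h' => h'.elim id fun h0 => ?_, Or.inl⟩
  rw [normSq_eq_zero.1 h0]; simp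

theorem isBounded_upperForm_neg : Bornology.IsBounded {z : ℂ | upperForm (fold z) < 0} := by
  refine (Metric.isBounded_closedBall (x := (0 : ℂ)) (r := 33)).subset fun z hz => ?_
  rw [mem_ofPred_eq] at hz
  have him := fold_im_nonneg z
  have h1 : 0 < (fold z).re := by
    by_contra! h
    exact hz.not_ge (upperForm_nonneg_of_re_nonpos him h)
  have h2 : (fold z).re < 1 := by
    by_contra! h
    exact hz.not_ge (upperForm_nonneg_of_dual_im_nonneg him
      (upperDualPeriod_im_nonneg_of_one_le_re him h))
  have h3 : (fold z).im < 16 := by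
    by_contra! h
    exact hz.not_ge (upperForm_nonneg_of_dual_im_nonneg him
      (upperDualPeriod_im_nonneg_of_le_im h1.le h))
  simp only [fold] at h1 h2 h3
  rw [mem_closedBall_zero_iff]
  have h4 : |z.re| ≤ 1 := abs_le.2 ⟨by linarith, by linarith⟩
  linarith [norm_le_abs_re_add_abs_im z]

/-- By the intermediate value theorem the form keeps its sign on a component of the complement; a
nonpositive value would confine the component to the bounded negative set. -/
theorem upperForm_pos_of_mem_weakRegion {z : ℂ} (hz : z ∈ weakRegion) :
    0 < upperForm (fold z) := by
  obtain ⟨hzC, hunb⟩ := hz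
  by_contra! hle
  apply hunb
  refine isBounded_upperForm_neg.subset fun w hw => ?_
  by_contra! hw'
  rw [mem_ofPred_eq, not_lt] at hw'
  have hcont : Continuous fun w => upperForm (fold w) := continuous_upperForm.comp continuous_fold
  obtain ⟨v, hv, hv0⟩ := isPreconnected_connectedComponentIn.intermediate_value
    (mem_connectedComponentIn hzC) hw hcont.continuousOn ⟨hle, hw'⟩
  exact connectedComponentIn_subset _ _ hv ((mem_marginalCurve_iff v).2 hv0)

/-! ### Phases of a, and comparison of central charges. -/

theorem a_re_nonneg (z : ℂ) : 0 ≤ (a z).re := by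
  rcases le_or_gt 0 z.im with h | h
  · rw [(periods_of_im_nonneg h).1]; exact upperPeriod_re_nonneg _
  · rw [(periods_of_im_neg h).1]; exact upperPeriod_re_nonneg _

theorem a_im_nonneg_of_re_eq_zero {z : ℂ} (hz : (a z).re = 0) : 0 ≤ (a z).im := by
  rcases le_or_gt 0 z.im with h | h
  · rw [(periods_of_im_nonneg h).1]; exact upperPeriod_im_nonneg _
  · rw [(periods_of_im_neg h).1, conj_re] at hz
    refine absurd hz (upperPeriod_re_pos ?_).ne'
    have := abs_pos.2 h.ne
    simp only [fold]
    positivity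

/-- The values of `a` lie in a half plane containing no two opposite points. -/
theorem a_eq_zero_of_eq_nonpos_mul {z z₀ : ℂ} {c : ℝ} (hc : c ≤ 0) (h : a z = c * a z₀) :
    a z = 0 := by
  have h1 := congrArg Complex.re h
  have h2 := congrArg Complex.im h
  rw [re_ofReal_mul] at h1
  rw [im_ofReal_mul] at h2
  have hr := a_re_nonneg z
  have hr₀ := a_re_nonneg z₀
  have e1 : (a z).re = 0 := le_antisymm (h1.le.trans (mul_nonpos_of_nonpos_of_nonneg hc hr₀)) hr
  rcases eq_or_ne c 0 with hc0 | hc0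
  · rw [h, hc0]; simp
  have e2 : (a z₀).re = 0 := by
    rw [e1] at h1
    exact (mul_eq_zero.1 h1.symm).resolve_left hc0
  have e3 : (a z).im = 0 := le_antisymm
    (h2.le.trans (mul_nonpos_of_nonpos_of_nonneg hc (a_im_nonneg_of_re_eq_zero e2)))
    (a_im_nonneg_of_re_eq_zero e1)
  exact Complex.ext e1 e3

theorem centralCharge_re (p q : ℝ) (z : ℂ) :
    (centralCharge p q z).re = p * (a z).re + q * (aD z).re := by
  simp [centralCharge]

theorem centralCharge_im (p q : ℝ) (z : ℂ) :
    (centralCharge p q z).im = p * (a z).im + q * (aD z).im := by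
  simp [centralCharge]

theorem one_lt_of_centralCharge_eq {p q : ℝ} (hpq : p ≠ 0 ∨ q ≠ 0) {z₀ z : ℂ}
    (hz₀ : z₀ ∈ marginalCurve) (hz : z ∈ weakRegion) {c : ℝ} (hc : 0 < c)
    (h : centralCharge p q z = c * centralCharge p q z₀) : 1 < c := by
  have hK := upperForm_pos_of_mem_weakRegion hz
  have hK₀ := (mem_marginalCurve_iff z₀).1 hz₀
  have hdiff := periods_difference_pos (z := z) (z₀ := z₀) fun h => by
    rw [h, hK₀] at hK; exact lt_irrefl _ hK
  rw [← form_eq_upperForm_fold, conj_mul_im] at hK hK₀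
  rw [conj_mul_im] at hdiff
  have hre := congrArg Complex.re h
  have him := congrArg Complex.im h
  rw [re_ofReal_mul, centralCharge_re, centralCharge_re] at hre
  rw [im_ofReal_mul, centralCharge_im, centralCharge_im] at him
  simp only [sub_re, sub_im] at hdiff
  generalize (a z).re = x at *
  generalize (a z).im = y at *
  generalize (aD z).re = u at *
  generalize (aD z).im = v at *
  generalize (a z₀).re = x₀ at *
  generalize (a z₀).im = y₀ at *
  generalize (aD z₀).re = u₀ at *
  generalize (aD z₀).im = v₀ at *
  -- The entries of Π(z) - cΠ(z₀) satisfy a nontrivial real linear relation, so their real and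
  -- imaginary parts form a singular 2 × 2 matrix.
  have hdet : (x - c * x₀) * (v - c * v₀) - (y - c * y₀) * (u - c * u₀) = 0 := by
    rcases hpq with hp | hq
    · refine (mul_eq_zero.1 ?_).resolve_left hp
      linear_combination (v - c * v₀) * hre - (u - c * u₀) * him
    · refine (mul_eq_zero.1 ?_).resolve_left hq
      linear_combination (x - c * x₀) * him - (y - c * y₀) * hre
  have hkey : (c - 1) * (x * v - y * u) = c * ((x - x₀) * (v - v₀) - (y - y₀) * (u - u₀)) := by
    linear_combination -hdet + (c ^ 2 - c) * hK₀
  have hpos : 0 < (c - 1) * (x * v - y * u) := hkey ▸ mul_pos hc hdiff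
  linarith [pos_of_mul_pos_left hpos hK.le]

end

end SeibergWitten

theorem mainTheorem1 (p q : ℝ) (hpq : p ≠ 0 ∨ q ≠ 0) (z₀ z : ℂ)
    (hz₀ : z₀ ∈ SeibergWitten.marginalCurve) (hz : z ∈ SeibergWitten.weakRegion)
    (him : (SeibergWitten.centralCharge p q z / SeibergWitten.centralCharge p q z₀).im = 0)
    (hre : q ≠ 0 →
      0 < (SeibergWitten.centralCharge p q z / SeibergWitten.centralCharge p q z₀).re) :
    ‖SeibergWitten.centralCharge p q z₀‖ < ‖SeibergWitten.centralCharge p q z‖ := by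
  open SeibergWitten in
  have haz : a z ≠ 0 := fun h => hz.1 (by
    rw [marginalCurve, Set.mem_ofPred_eq, h, div_zero, Complex.zero_im])
  rcases eq_or_ne (centralCharge p q z₀) 0 with hf | hf
  -- The quotient by f(z₀) = 0 is 0 by convention, which contradicts the phase condition unless q =
  -- 0.
  · have hq : q = 0 := by
      by_contra hq
      have := hre hq
      simp [hf] at this
    have hp : p ≠ 0 := hpq.resolve_right (not_not.2 hq)
    rw [hf, norm_zero, norm_pos_iff, centralCharge, hq]
    simpa using ⟨hp, haz⟩
  · set c : ℝ := (centralCharge p q z / centralCharge p q z₀).re with hc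
    have hfc : centralCharge p q z = c * centralCharge p q z₀ := by
      rw [← div_eq_iff hf]
      exact Complex.ext rfl (by rw [him, Complex.ofReal_im])
    have hcpos : 0 < c := by
      by_cases hq : q = 0
      · have hp : p ≠ 0 := hpq.resolve_right (not_not.2 hq)
        have haa : a z = c * a z₀ := by
          have hp' : (p : ℂ) ≠ 0 := Complex.ofReal_ne_zero.2 hp
          refine mul_left_cancel₀ hp' ?_
          simp only [centralCharge, hq, Complex.ofReal_zero, zero_mul, add_zero] at hfc
          rw [hfc]; ring
        by_contra! hle
        exact haz (a_eq_zero_of_eq_nonpos_mul hle haa)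
      · exact hre hq
    have h1 := one_lt_of_centralCharge_eq hpq hz₀ hz hcpos hfc
    rw [hfc, norm_mul, Complex.norm_real, Real.norm_of_nonneg hcpos.le]
    exact lt_mul_of_one_lt_left (norm_pos_iff.2 hf) h1
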